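/- Let $\Phi$ be a finite, irreducible, reduced, crystallographic root system of rank $n$ in the Euclidean space $\mathrm{Span}_{\mathbb R}\Phi$ with scalar product $(\cdot,\cdot)$, let $\Pi=\{\alpha_1,\dots,\alpha_n\}$ be a basis of simple roots, $\breve\omega_1,\dots,\breve\omega_n$ the dual basis of $\Pi$ (the fundamental coweights), and $\theta=\sum_{i=1}^n m_i\alpha_i$ the highest root. Let $\mathcal P_\Phi$ be the convex hull of $\Phi$ and, for $I\subseteq\{1,\dots,n\}$, put $\Pi_I=\{\alpha_i\mid i\in I\}$ and $$F_I=\{x\in\mathcal P_\Phi\mid (\breve\omega_i,x)=m_i\ \text{for all } i\in I\}.$$ Let $\widehat\Phi=\{\alpha+k\delta\mid \alpha\in\Phi,\ k\in\mathbb Z\}\subset \mathrm{Span}_{\mathbb R}\Phi\oplus\mathbb R\delta$ be the affine root system of $\Phi$, where the scalar product is extended to a bilinear form with kernel $\mathbb R\delta$; let $\alpha_0=-\theta+\delta$ and $\widehat\Pi=\{\alpha_0\}\cup\Pi$. Let $\overline I$ be the set of all $k\in\{1,\dots,n\}$ such that $\alpha_k$ does not belong to the irreducible component containing $\alpha_0$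 of the root subsystem of $\widehat\Phi$ generated by $\widehat\Pi\setminus\Pi_I$. For $\Gamma\subseteq\Phi$ let $W\langle\Gamma\rangle$ be the group generated by the reflections in the roots of $\Gamma$, and let $\theta^\perp$ be the set of vectors orthogonal to $\theta$. Then, for every $I\subseteq\{1,\dots,n\}$, the number of vertices of $F_I$ is finite and equal to the index $$[\,W\langle\Pi\setminus\Pi_{\overline I}\rangle : W\langle(\Pi\setminus\Pi_{\overline I})\cap\theta^\perp\rangle\,].$$ -/

import Mathlib

namespace RootPairing.Base

section HighestRoot

variable {ι M N : Type*} [AddCommGroup M] [Module ℝ M] [AddCommGroup N] [Module ℝ N]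
  {P : RootPairing ι ℝ M N}

/-- `θ` (an index of a root) is the highest root with respect to the base `b`: for every root `β`
the difference `θ - β` is a sum of simple roots. -/
def IsHighestRoot (b : P.Base) (θ : ι) : Prop :=
  ∀ i, P.root θ - P.root i ∈ AddSubmonoid.closure (P.root '' b.support)

variable [P.IsRootSystem]

lemma coord_nonneg_of_mem_closure (b : P.Base) {x : M}
    (hx : x ∈ AddSubmonoid.closure (P.root '' b.support)) (j : b.support) :
    0 ≤ b.toWeightBasis.coord j x := by
  induction hx using AddSubmonoid.closure_induction with
  | mem x hx =>
    obtain ⟨i, hi, rfl⟩ := hx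
    have := b.toWeightBasis_repr_root ⟨i, hi⟩
    simp only at this
    classical
    rw [Module.Basis.coord_apply, this, Finsupp.single_apply]
    split_ifs <;> norm_num
  | zero => simp
  | add x y _ _ h1 h2 => rw [map_add]; exact add_nonneg h1 h2

lemma root_eq_sum_coord (b : P.Base) (i : ι) :
    P.root i = ∑ j : b.support, b.toWeightBasis.coord j (P.root i) • P.root j := by
  conv_lhs => rw [← b.toWeightBasis.sum_repr (P.root i)]
  simp

lemma pairing_eq_sum_coord (b : P.Base) (i k : ι) :
    P.pairing i k = ∑ j : b.support, b.toWeightBasis.coord j (P.root i) * P.pairing j k := by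
  rw [← P.root_coroot_eq_pairing]
  conv_lhs => rw [b.root_eq_sum_coord i]
  simp

lemma sum_coord_nonneg (b : P.Base) {x : M}
    (hx : x ∈ AddSubmonoid.closure (P.root '' b.support)) :
    0 ≤ ∑ j, b.toWeightBasis.coord j x :=
  Finset.sum_nonneg fun j _ ↦ b.coord_nonneg_of_mem_closure hx j

variable [Finite ι] [P.IsCrystallographic]

/-- A root which is maximal (in the order given by the sums of simple roots) is dominant. -/
lemma pairing_nonneg_of_maximal (b : P.Base) {c : ι}
    (hc : ∀ d, P.root d - P.root c ∈ AddSubmonoid.closure (P.root '' b.support) →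
      ∑ j, b.toWeightBasis.coord j (P.root d) ≤ ∑ j, b.toWeightBasis.coord j (P.root c))
    (j : b.support) : 0 ≤ P.pairingIn ℤ c j := by
  by_contra! h
  have hj : P.root j ∈ AddSubmonoid.closure (P.root '' b.support) :=
    AddSubmonoid.subset_closure ⟨j, j.2, rfl⟩
  have hj1 : ∑ k, b.toWeightBasis.coord k (P.root j) = 1 := by
    classical
    simp only [Module.Basis.coord_apply, b.toWeightBasis_repr_root, Finsupp.single_apply]
    simp
  by_cases hn : P.root c = -P.root j
  · have := hc j (by rw [hn, sub_neg_eq_add]; exact add_mem hj hj)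
    rw [hn] at this
    simp only [map_neg, Finset.sum_neg_distrib, hj1] at this
    norm_num at this
  · obtain ⟨d, hd⟩ := P.root_add_root_mem_of_pairingIn_neg h hn
    have := hc d (by rw [hd, add_sub_cancel_left]; exact hj)
    rw [hd] at this
    simp only [map_add, Finset.sum_add_distrib, hj1] at this
    linarith

lemma pairing_nonneg_symm {i j : ι} (h : 0 ≤ P.pairingIn ℤ i j) : 0 ≤ P.pairing j i := by
  have h2 : 0 ≤ P.pairingIn ℤ j i := by
    rcases h.eq_or_lt with h | h
    · exact (P.pairingIn_eq_zero_iff.1 h.symm).ge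
    · exact ((P.zero_lt_pairingIn_iff' ℤ).1 h).le
  rw [← P.algebraMap_pairingIn ℤ]; simpa using h2

variable [P.IsReduced] [P.IsIrreducible]

lemma coord_pos_of_dominant (b : P.Base) {c : ι} (hc : ∀ j : b.support, 0 ≤ P.pairingIn ℤ c j)
    (j : b.support) : 0 < b.toWeightBasis.coord j (P.root c) := by
  have hc' (j : b.support) : 0 ≤ P.pairing c j := by
    rw [← P.algebraMap_pairingIn ℤ]; simpa using hc j
  have hc'' (j : b.support) : 0 ≤ P.pairing j c :=
    pairing_nonneg_symm (hc j)
  have hpos (j : b.support) : 0 ≤ b.toWeightBasis.coord j (P.root c) := by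
    rcases b.root_mem_or_neg_mem c with h | h
    · exact b.coord_nonneg_of_mem_closure h j
    · exfalso
      have h2 := b.pairing_eq_sum_coord c c
      rw [P.pairing_same] at h2
      have : ∑ j : b.support, b.toWeightBasis.coord j (P.root c) * P.pairing j c ≤ 0 := by
        refine Finset.sum_nonpos fun k _ ↦ mul_nonpos_of_nonpos_of_nonneg ?_ (hc'' k)
        have := b.coord_nonneg_of_mem_closure h k
        rw [map_neg] at this
        linarith
      linarith
  obtain ⟨i, hi⟩ : ∃ i, 0 < b.toWeightBasis.coord i (P.root c) := by
    by_contra! h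
    apply P.ne_zero c
    rw [b.root_eq_sum_coord c]
    exact Finset.sum_eq_zero fun k _ ↦ by rw [le_antisymm (h k) (hpos k), zero_smul]
  refine b.induction_on_cartanMatrix (fun j ↦ 0 < b.toWeightBasis.coord j (P.root c)) hi ?_
  intro k l hk hkl
  by_contra hl
  have hl0 := le_antisymm (not_lt.1 hl) (hpos l)
  have hkl' : P.pairing k l ≠ 0 := by
    rw [Ne, cartanMatrix_apply_eq_zero_iff_symm, cartanMatrix_apply_eq_zero_iff_pairing] at hkl
    exact hkl
  have hne : k ≠ l := by rintro rfl; exact hl hk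
  have hle (m : b.support) (hm : m ≠ l) : P.pairing m l ≤ 0 := by
    have := b.pairingIn_le_zero_of_ne (fun h ↦ hm (Subtype.ext h)) m.2 l.2
    rw [← P.algebraMap_pairingIn ℤ]; simpa using this
  have h1 := b.pairing_eq_sum_coord c l
  have h2 : ∑ j : b.support, b.toWeightBasis.coord j (P.root c) * P.pairing j l < 0 := by
    refine Finset.sum_neg' (fun m _ ↦ ?_) ⟨k, Finset.mem_univ _, ?_⟩
    · by_cases hm : m = l
      · rw [hm, hl0, zero_mul]
      · exact mul_nonpos_of_nonneg_of_nonpos (hpos m) (hle m hm)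
    · exact mul_neg_of_pos_of_neg hk (lt_of_le_of_ne (hle k hne) hkl')
  linarith [hc' l]

/-- A reduced irreducible root system has a highest root. -/
theorem exists_isHighestRoot (b : P.Base) : ∃ θ, b.IsHighestRoot θ := by
  have key (i : ι) : ∃ c, P.root c - P.root i ∈ AddSubmonoid.closure (P.root '' b.support) ∧
      ∀ d, P.root d - P.root c ∈ AddSubmonoid.closure (P.root '' b.support) →
      ∑ j, b.toWeightBasis.coord j (P.root d) ≤ ∑ j, b.toWeightBasis.coord j (P.root c) := by
    obtain ⟨c, hc, hmax⟩ := Set.exists_max_image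
      {c | P.root c - P.root i ∈ AddSubmonoid.closure (P.root '' b.support)}
      (fun c ↦ ∑ j, b.toWeightBasis.coord j (P.root c)) (Set.toFinite _) ⟨i, by simp⟩
    refine ⟨c, hc, fun d hd ↦ hmax d ?_⟩
    have := add_mem hd hc
    simpa using this
  obtain ⟨i₀⟩ : Nonempty ι := by
    by_contra h
    rw [not_nonempty_iff] at h
    have h1 := IsRootSystem.span_root_eq_top (P := P)
    have : Nontrivial M := IsIrreducible.nontrivial P
    rw [Set.range_eq_empty, Submodule.span_empty] at h1
    exact bot_ne_top h1
  obtain ⟨t, -, ht⟩ := key i₀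
  refine ⟨t, fun i ↦ ?_⟩
  obtain ⟨c, hci, hc⟩ := key i
  suffices c = t by rwa [← this]
  by_contra hne
  have hcd := b.pairing_nonneg_of_maximal hc
  have htd := b.pairing_nonneg_of_maximal ht
  have htd' (j : b.support) : 0 ≤ P.pairing j t :=
    pairing_nonneg_symm (htd j)
  have hp : 0 < P.pairing c t := by
    rw [b.pairing_eq_sum_coord c t]
    refine Finset.sum_pos' (fun j _ ↦ mul_nonneg (b.coord_pos_of_dominant hcd j).le (htd' j)) ?_
    by_contra! h
    have h2 := b.pairing_eq_sum_coord t t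
    have h3 : ∑ j : b.support, b.toWeightBasis.coord j (P.root t) * P.pairing j t ≤ 0 := by
      refine Finset.sum_nonpos fun j hj ↦ ?_
      have h4 : P.pairing j t ≤ 0 := by
        by_contra! h5
        exact absurd (h j hj) (not_le.2 (mul_pos (b.coord_pos_of_dominant hcd j) h5))
      exact mul_nonpos_of_nonneg_of_nonpos (b.coord_pos_of_dominant htd j).le h4
    rw [P.pairing_same] at h2
    linarith
  have hp' : 0 < P.pairingIn ℤ c t := by
    rw [← P.algebraMap_pairingIn ℤ] at hp; simpa using hp
  obtain ⟨k, hk⟩ := P.root_sub_root_mem_of_pairingIn_pos hp' hne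
  have hzero : ∀ x ∈ AddSubmonoid.closure (P.root '' b.support),
      ∑ j, b.toWeightBasis.coord j x ≤ 0 → x = 0 := by
    intro x hx h
    have h1 := (Finset.sum_eq_zero_iff_of_nonneg
      (fun j _ ↦ b.coord_nonneg_of_mem_closure hx j)).1 (le_antisymm h (b.sum_coord_nonneg hx))
    apply b.toWeightBasis.ext_elem
    intro j
    simpa using h1 j (Finset.mem_univ _)
  rcases b.root_mem_or_neg_mem k with h | h
  · refine P.ne_zero k (hzero _ h ?_)
    have := ht c (hk ▸ h)
    simp only [hk, map_sub, Finset.sum_sub_distrib]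
    linarith
  · refine P.ne_zero k (neg_eq_zero.1 (hzero _ h ?_))
    have := hc t (by rw [hk, neg_sub] at h; exact h)
    simp only [hk, map_neg, map_sub, Finset.sum_neg_distrib, Finset.sum_sub_distrib]
    linarith

/-- The highest root `θ` (as an index of a root). -/
noncomputable def highestRoot (b : P.Base) : ι := b.exists_isHighestRoot.choose

lemma isHighestRoot_highestRoot (b : P.Base) : b.IsHighestRoot b.highestRoot :=
  b.exists_isHighestRoot.choose_spec

end HighestRoot

end RootPairing.Base

namespace RootPairing

section Affine

variable {ι M N : Type*} [AddCommGroup M] [Module ℝ M] [AddCommGroup N] [Module ℝ N]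
  (P : RootPairing ι ℝ M N)

/-- The affine root system of `Φ` consists of the vectors `α + kδ` of `span Φ ⊕ ℝδ`, with `α ∈ Φ`
and `k ∈ ℤ`. We index it by `ι × ℤ`; this is the vector `α + kδ` with index `(α, k)`, the space
`span Φ ⊕ ℝδ` being written as `M × ℝ`. -/
def affineRoot (a : ι × ℤ) : M × ℝ := (P.root a.1, (a.2 : ℝ))

lemma affineRoot_injective : Function.Injective P.affineRoot := by
  rintro ⟨i, k⟩ ⟨j, l⟩ h
  simp only [affineRoot, Prod.mk.injEq, EmbeddingLike.apply_eq_iff_eq, Int.cast_inj] at h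
  simp [h]

/-- The (index of the) affine root obtained from `b = β + lδ` by the reflection in the affine root
`a = α + kδ`, namely `b - ⟨β, α^∨⟩ a`. -/
noncomputable def affineReflection [P.IsCrystallographic] (a b : ι × ℤ) : ι × ℤ :=
  (P.reflectionPerm a.1 b.1, b.2 - P.pairingIn ℤ b.1 a.1 * a.2)

lemma affineRoot_affineReflection [P.IsCrystallographic] (a b : ι × ℤ) :
    P.affineRoot (P.affineReflection a b) =
      P.affineRoot b - P.pairing b.1 a.1 • P.affineRoot a := by
  have : ((P.pairingIn ℤ b.1 a.1 : ℤ) : ℝ) = P.pairing b.1 a.1 := by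
    rw [← P.algebraMap_pairingIn ℤ]; simp
  simp [affineRoot, affineReflection, reflection_apply_root, this]

/-- The root subsystem of the affine root system generated by a set `Γ` of affine roots: the
smallest set of affine roots that contains `Γ` and is stable under the reflections in its
members. -/
inductive affineSubsystem [P.IsCrystallographic] (Γ : Set (ι × ℤ)) : Set (ι × ℤ)
  | of (a : ι × ℤ) (ha : a ∈ Γ) : affineSubsystem Γ a
  | reflect (a b : ι × ℤ) (ha : affineSubsystem Γ a) (hb : affineSubsystem Γ b) :
      affineSubsystem Γ (P.affineReflection a b)

/-- The irreducible component containing `a` of a set `Ψ` of affine roots: the members of `Ψ` that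
can be joined to `a` by a finite sequence of members of `Ψ` in which consecutive ones are not
orthogonal. Here `α + kδ` and `β + lδ` are orthogonal if and only if `α` and `β` are, since `δ` lies
in the kernel of the bilinear form. -/
def affineComponent (Ψ : Set (ι × ℤ)) (a : ι × ℤ) : Set (ι × ℤ) :=
  {b | a ∈ Ψ ∧ Relation.ReflTransGen (fun x y ↦ y ∈ Ψ ∧ ¬ P.IsOrthogonal x.1 y.1) a b}

/-- For a set `Γ` of roots, `W⟨Γ⟩` is the group generated by the reflections in the members
of `Γ`. -/
def reflectionSubgroup (Γ : Set ι) : Subgroup (M ≃ₗ[ℝ] M) :=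
  Subgroup.closure (P.reflection '' Γ)

/-- The root polytope: the convex hull of all roots. -/
def rootPolytope : Set M := convexHull ℝ (Set.range P.root)

end Affine

end RootPairing

namespace RootPairing.Base

section Faces

variable {ι M N : Type*} [Finite ι] [AddCommGroup M] [Module ℝ M] [AddCommGroup N] [Module ℝ N]
  {P : RootPairing ι ℝ M N} [P.IsRootSystem] [P.IsCrystallographic] [P.IsReduced]
  [P.IsIrreducible]

/-- The standard parabolic face `F_I`: the points `x` of the root polytope such that, for all
`i ∈ I`, the `i`-th coordinate of `x` with respect to the simple roots (that is, the value at `x` of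
the `i`-th fundamental coweight) equals the `i`-th coordinate `m_i` of the highest root. -/
def standardFace (b : P.Base) (I : Set b.support) : Set M :=
  {x | x ∈ P.rootPolytope ∧
    ∀ i ∈ I, b.toWeightBasis.coord i x = b.toWeightBasis.coord i (P.root b.highestRoot)}

/-- The affine simple root `α₀ = -θ + δ`; the index of the root `-θ` is `reflectionPerm θ θ`. -/
noncomputable def affineSimpleRoot (b : P.Base) : ι × ℤ :=
  (P.reflectionPerm b.highestRoot b.highestRoot, 1)

lemma affineRoot_affineSimpleRoot (b : P.Base) :
    P.affineRoot b.affineSimpleRoot = (-P.root b.highestRoot, 1) := by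
  simp [affineRoot, affineSimpleRoot]

/-- The set `Π̂ ∖ Π_I`, where `Π̂ = {α₀} ∪ Π`, as a set of affine roots. -/
def affineSimpleRootsDiff (b : P.Base) (I : Set b.support) : Set (ι × ℤ) :=
  insert b.affineSimpleRoot ((fun i : b.support ↦ ((i : ι), (0 : ℤ))) '' Iᶜ)

/-- The closure `Ī` of `I`: the set of those `k` for which the simple root `α_k` is not in the
irreducible component of `α₀` in the affine root subsystem generated by `Π̂ ∖ Π_I`. -/
def faceClosure (b : P.Base) (I : Set b.support) : Set b.support :=
  {k | ((k : ι), (0 : ℤ)) ∉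
    P.affineComponent (P.affineSubsystem (b.affineSimpleRootsDiff I)) b.affineSimpleRoot}

/-- The set of simple roots `Π ∖ Π_J`. -/
def simpleRootsDiff (b : P.Base) (J : Set b.support) : Set ι :=
  Subtype.val '' Jᶜ

/-- The set of roots in `θ^⊥`, that is, orthogonal to the highest root. -/
def orthogonalToHighestRoot (b : P.Base) : Set ι :=
  {i | P.IsOrthogonal i b.highestRoot}

end Faces

end RootPairing.Base

/-! The count is orbit–stabilizer for the highest root `θ` under `W⟨Π ∖ Π_Ī⟩`. The face `F_I` is an
extreme subset of the polytope, so its vertices are roots, and they are permuted by the simple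
reflections outside `I`. Raising a vertex by these reflections ends at one that is dominant outside
`I`, and convexity forces that one to be `θ` (`eq_highestRoot_of_mem_extremePoints`). Simple
reflections in `Ī ∖ I` fix `θ` and commute with those outside `Ī`, so they add nothing to the orbit
(`extremePoints_standardFace_eq`). Since `θ` is dominant, the exchange condition shows that its
stabilizer is generated by the simple reflections fixing it (`wordReflection_mem_of_fix`). -/

namespace RootPairing

/-! ### Words in reflections -/

section Words

variable {ι M N : Type*} [AddCommGroup M] [Module ℝ M] [AddCommGroup N] [Module ℝ N]
  (P : RootPairing ι ℝ M N)

/-- The product of the reflections in a list of roots. -/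
def wordReflection (L : List ι) : M ≃ₗ[ℝ] M := (L.map P.reflection).prod

/-- The permutation of the roots given by the product of the reflections in a list of roots. -/
def wordPerm (L : List ι) : Equiv.Perm ι := (L.map P.reflectionPerm).prod

@[simp]
lemma wordReflection_nil : P.wordReflection [] = 1 := rfl

@[simp]
lemma wordReflection_cons (i : ι) (L : List ι) :
    P.wordReflection (i :: L) = P.reflection i * P.wordReflection L := by
  simp [wordReflection]

lemma wordReflection_append (L₁ L₂ : List ι) :
    P.wordReflection (L₁ ++ L₂) = P.wordReflection L₁ * P.wordReflection L₂ := by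
  simp [wordReflection]

@[simp]
lemma wordPerm_nil : P.wordPerm [] = 1 := rfl

@[simp]
lemma wordPerm_cons (i : ι) (L : List ι) :
    P.wordPerm (i :: L) = P.reflectionPerm i * P.wordPerm L := by
  simp [wordPerm]

lemma root_wordPerm (L : List ι) (i : ι) :
    P.root (P.wordPerm L i) = P.wordReflection L (P.root i) := by
  induction L with
  | nil => simp
  | cons j L ih => simp [ih]

lemma pairing_wordPerm (L : List ι) (i j : ι) :
    P.pairing (P.wordPerm L i) (P.wordPerm L j) = P.pairing i j := by
  induction L with
  | nil => simp
  | cons k L ih => simp only [wordPerm_cons, Equiv.Perm.mul_apply, pairing_reflectionPerm,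
      reflectionPerm_self, ih]

lemma reflection_mul_self (i : ι) : P.reflection i * P.reflection i = 1 := by
  rw [← sq, reflection_sq]

/-- Conjugation rule for reflections, written without inverses; it drives the exchange condition. -/
lemma reflection_wordPerm_mul (L : List ι) (i : ι) :
    P.reflection (P.wordPerm L i) * P.wordReflection L = P.wordReflection L * P.reflection i := by
  induction L with
  | nil => simp
  | cons j L ih =>
    rw [wordPerm_cons, wordReflection_cons, Equiv.Perm.mul_apply, reflection_reflectionPerm,
      mul_assoc, ← mul_assoc (P.reflection j) (P.reflection j), reflection_mul_self, one_mul,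
      mul_assoc, ih, mul_assoc]

lemma wordReflection_mem_reflectionSubgroup {Γ : Set ι} {L : List ι} (hL : ∀ i ∈ L, i ∈ Γ) :
    P.wordReflection L ∈ P.reflectionSubgroup Γ := by
  refine Subgroup.list_prod_mem _ fun x hx ↦ ?_
  obtain ⟨i, hi, rfl⟩ := List.mem_map.1 hx
  exact Subgroup.subset_closure ⟨i, hL i hi, rfl⟩

lemma exists_wordReflection_eq {Γ : Set ι} {w : M ≃ₗ[ℝ] M} (hw : w ∈ P.reflectionSubgroup Γ) :
    ∃ L : List ι, (∀ i ∈ L, i ∈ Γ) ∧ P.wordReflection L = w := by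
  induction hw using Subgroup.closure_induction with
  | mem x hx =>
    obtain ⟨i, hi, rfl⟩ := hx
    exact ⟨[i], by simpa using hi, by simp⟩
  | one => exact ⟨[], by simp, rfl⟩
  | mul x y _ _ hx hy =>
    obtain ⟨L, hL, rfl⟩ := hx
    obtain ⟨L', hL', rfl⟩ := hy
    exact ⟨L ++ L', by grind, P.wordReflection_append L L'⟩
  | inv x _ hx =>
    obtain ⟨L, hL, rfl⟩ := hx
    refine ⟨L.reverse, by simpa using hL, ?_⟩
    have h : (fun x ↦ x⁻¹) ∘ P.reflection = P.reflection := funext fun i ↦ P.reflection_inv i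
    simp only [wordReflection, List.prod_inv_reverse, List.map_map, List.map_reverse, h]

lemma reflectionSubgroup_mono {Γ Δ : Set ι} (h : Γ ⊆ Δ) :
    P.reflectionSubgroup Γ ≤ P.reflectionSubgroup Δ :=
  Subgroup.closure_mono (Set.image_mono h)

end Words

end RootPairing

namespace RootPairing.Base

/-! ### Exchange condition and stabilizers of dominant roots -/

section Stabilizer

variable {ι M N : Type*} [Finite ι] [AddCommGroup M] [Module ℝ M] [AddCommGroup N] [Module ℝ N]
  {P : RootPairing ι ℝ M N} [P.IsCrystallographic] (b : P.Base) {c : ι}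

lemma pairing_nonneg_of_isPos (hc : ∀ j ∈ b.support, 0 ≤ P.pairing j c) {i : ι} (hi : b.IsPos i) :
    0 ≤ P.pairing i c := by
  refine hi.induction_on_add hc fun i j k hk h h' ↦ ?_
  have : P.pairing k c = P.pairing i c + P.pairing j c := by
    simp only [← P.root_coroot_eq_pairing, hk, map_add, LinearMap.add_apply]
  linarith [hc j h']

lemma pairing_nonpos_of_not_isPos (hc : ∀ j ∈ b.support, 0 ≤ P.pairing j c) {i : ι}
    (hi : ¬ b.IsPos i) : P.pairing i c ≤ 0 := by
  have h := b.pairing_nonneg_of_isPos hc ((IsPos.neg_iff_not b i).2 hi)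
  rw [indexNeg_neg, pairing_reflectionPerm_self_left] at h
  linarith

variable [P.IsReduced]

/-- The exchange condition for words in simple reflections. -/
lemma exists_wordReflection_eq_mul_reflection {L : List ι} (hL : ∀ i ∈ L, i ∈ b.support) {j : ι}
    (hj : j ∈ b.support) (h : ¬ b.IsPos (P.wordPerm L j)) :
    ∃ L', L'.Sublist L ∧ L'.length + 1 = L.length ∧
      P.wordReflection L = P.wordReflection L' * P.reflection j := by
  induction L with
  | nil => exact absurd (b.isPos_of_mem_support hj) h
  | cons i L ih =>
    -- Find the letter at which the image of `α_j` turns negative. A simple reflection makes only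
    -- its own simple root negative among the positive ones, so that image is `α_i`, and conjugation
    -- moves the letter to the right end as `s_j`.
    by_cases hpos : b.IsPos (P.wordPerm L j)
    · have hi : P.wordPerm L j = i := by
        by_contra hne
        exact h (by simpa using hpos.reflectionPerm (hL i (by simp)) hne)
      refine ⟨L, List.sublist_cons_self i L, rfl, ?_⟩
      rw [wordReflection_cons, ← reflection_wordPerm_mul, hi]
    · obtain ⟨L', h₁, h₂, h₃⟩ := ih (fun k hk ↦ hL k (by simp [hk])) hpos
      refine ⟨i :: L', h₁.cons_cons i, by simp [h₂], ?_⟩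
      simp [h₃, mul_assoc]

/-- An element of a standard parabolic subgroup of the Weyl group that fixes a dominant root is a
product of simple reflections that fix this root. -/
theorem wordReflection_mem_of_fix (hc : ∀ j ∈ b.support, 0 ≤ P.pairing j c) {Γ : Set ι}
    (hΓ : Γ ⊆ b.support) {L : List ι} (hL : ∀ i ∈ L, i ∈ Γ)
    (h : P.wordReflection L (P.root c) = P.root c) :
    P.wordReflection L ∈ P.reflectionSubgroup (Γ ∩ {i | P.IsOrthogonal i c}) := by
  induction hn : L.length using Nat.strong_induction_on generalizing L with
  | _ n ih =>
    rcases L.eq_nil_or_concat' with rfl | ⟨L, j, rfl⟩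
    · exact one_mem _
    have hj : j ∈ Γ := hL j (by simp)
    have hL' (i : ι) (hi : i ∈ L) : i ∈ Γ := hL i (by simp [hi])
    by_cases hpos : b.IsPos (P.wordPerm L j)
    -- The full word fixes `c` and sends `α_j` to a negative root. By invariance the pairing of
    -- `α_j` with `c` is therefore also nonpositive, so the last letter fixes `c` and can be split
    -- off.
    · have hcj : P.pairing j c = 0 := by
        refine le_antisymm ?_ (hc j (hΓ hj))
        have hfix : P.wordPerm (L ++ [j]) c = c := P.root.injective (by rw [root_wordPerm, h])
        have := P.pairing_wordPerm (L ++ [j]) j c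
        rw [hfix] at this
        rw [← this]
        refine b.pairing_nonpos_of_not_isPos hc ?_
        have hneg : P.wordPerm (L ++ [j]) j =
            P.reflectionPerm (P.wordPerm L j) (P.wordPerm L j) := by
          apply P.root.injective
          rw [root_reflectionPerm, reflection_apply_self, root_wordPerm, root_wordPerm,
            wordReflection_append]
          simp
        rw [hneg]
        exact fun h' ↦ (IsPos.neg_iff_not b _).1 h' hpos
      have horth : P.IsOrthogonal j c := ⟨hcj, P.pairing_eq_zero_iff.1 hcj⟩
      rw [wordReflection_append] at h ⊢
      refine mul_mem (ih L.length (by simp [← hn]) hL' ?_ rfl) ?_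
      · simpa [horth.reflection_apply_right] using h
      · exact P.wordReflection_mem_reflectionSubgroup (by simpa using ⟨hj, horth⟩)
    -- Exchange produces a second `s_j` that cancels the last letter, leaving a shorter word for the
    -- same element.
    · obtain ⟨L', h₁, h₂, h₃⟩ :=
        b.exists_wordReflection_eq_mul_reflection (fun i hi ↦ hΓ (hL' i hi)) (hΓ hj) hpos
      have heq : P.wordReflection (L ++ [j]) = P.wordReflection L' := by
        simp [wordReflection_append, h₃, mul_assoc, reflection_mul_self]
      rw [heq] at h ⊢
      exact ih L'.length (by simp [← hn]; omega) (fun i hi ↦ hL' i (h₁.subset hi)) h rfl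

theorem ncard_orbit_eq_relIndex (hc : ∀ j ∈ b.support, 0 ≤ P.pairing j c) {Γ : Set ι}
    (hΓ : Γ ⊆ b.support) :
    {x | ∃ w ∈ P.reflectionSubgroup Γ, w (P.root c) = x}.ncard =
      (P.reflectionSubgroup (Γ ∩ {i | P.IsOrthogonal i c})).relIndex (P.reflectionSubgroup Γ) := by
  have hstab : (P.reflectionSubgroup (Γ ∩ {i | P.IsOrthogonal i c})).subgroupOf
      (P.reflectionSubgroup Γ) =
      MulAction.stabilizer (P.reflectionSubgroup Γ) (P.root c) := by
    ext ⟨w, hw⟩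
    rw [Subgroup.mem_subgroupOf, MulAction.mem_stabilizer_iff]
    change w ∈ _ ↔ w (P.root c) = P.root c
    refine ⟨fun h ↦ ?_, fun h ↦ ?_⟩
    · clear hw
      induction h using Subgroup.closure_induction with
      | mem x hx =>
        obtain ⟨i, hi, rfl⟩ := hx
        exact IsOrthogonal.reflection_apply_right hi.2
      | one => rfl
      | mul x y _ _ h₁ h₂ => rw [LinearEquiv.mul_apply, h₂, h₁]
      | inv x _ h₁ => exact (LinearEquiv.symm_apply_eq x).2 h₁.symm
    · obtain ⟨L, hL, rfl⟩ := P.exists_wordReflection_eq hw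
      exact b.wordReflection_mem_of_fix hc hΓ hL h
  rw [Subgroup.relIndex, hstab, MulAction.index_stabilizer]
  congr 1
  ext x
  simp only [Set.mem_ofPred_eq, MulAction.mem_orbit_iff, Subtype.exists]
  exact exists_congr fun w ↦ ⟨fun ⟨h, h'⟩ ↦ ⟨h, h'⟩, fun ⟨h, h'⟩ ↦ ⟨h, h'⟩⟩

end Stabilizer

end RootPairing.Base

namespace RootPairing

/-! ### Symmetries of the root polytope -/

section RootPolytope

variable {ι M N : Type*} [AddCommGroup M] [Module ℝ M] [AddCommGroup N] [Module ℝ N]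
  {P : RootPairing ι ℝ M N}

lemma root_mem_rootPolytope (i : ι) : P.root i ∈ P.rootPolytope :=
  subset_convexHull ℝ _ ⟨i, rfl⟩

lemma neg_root_mem_rootPolytope (i : ι) : -P.root i ∈ P.rootPolytope :=
  subset_convexHull ℝ _ ⟨P.reflectionPerm i i, by simp⟩

lemma reflection_mem_rootPolytope {x : M} (hx : x ∈ P.rootPolytope) (i : ι) :
    P.reflection i x ∈ P.rootPolytope := by
  have h : (P.reflection i).toLinearMap '' P.rootPolytope = P.rootPolytope := by
    rw [rootPolytope, LinearMap.image_convexHull]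
    exact congrArg _ (P.reflection_image_eq i)
  exact h.subset (Set.mem_image_of_mem _ hx)

end RootPolytope

end RootPairing

namespace RootPairing.Base

/-! ### Simple-root coordinates -/

section Coordinates

variable {ι M N : Type*} [AddCommGroup M] [Module ℝ M] [AddCommGroup N] [Module ℝ N]
  {P : RootPairing ι ℝ M N} [P.IsRootSystem] (b : P.Base)

lemma coord_root_self (j : b.support) : b.toWeightBasis.coord j (P.root j) = 1 := by
  rw [Module.Basis.coord_apply, b.toWeightBasis_repr_root, Finsupp.single_eq_same]

lemma coord_root_of_ne {i j : b.support} (h : i ≠ j) :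
    b.toWeightBasis.coord i (P.root j) = 0 := by
  rw [Module.Basis.coord_apply, b.toWeightBasis_repr_root, Finsupp.single_eq_of_ne h]

end Coordinates

/-! ### Vertices of standard faces -/

section Vertices

variable {ι M N : Type*} [Finite ι] [AddCommGroup M] [Module ℝ M] [AddCommGroup N] [Module ℝ N]
  {P : RootPairing ι ℝ M N} [P.IsRootSystem] [P.IsCrystallographic] [P.IsReduced]
  [P.IsIrreducible] (b : P.Base)

lemma coord_root_le (i : ι) (j : b.support) :
    b.toWeightBasis.coord j (P.root i) ≤ b.toWeightBasis.coord j (P.root b.highestRoot) := by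
  have := b.coord_nonneg_of_mem_closure (b.isHighestRoot_highestRoot i) j
  rw [map_sub] at this
  linarith

lemma coord_le_of_mem_rootPolytope {x : M} (hx : x ∈ P.rootPolytope) (j : b.support) :
    b.toWeightBasis.coord j x ≤ b.toWeightBasis.coord j (P.root b.highestRoot) := by
  have h : P.rootPolytope ⊆ {x | b.toWeightBasis.coord j x ≤
      b.toWeightBasis.coord j (P.root b.highestRoot)} := by
    refine convexHull_min ?_ (convex_halfSpace_le (LinearMap.isLinear _) _)
    rintro - ⟨i, rfl⟩
    exact b.coord_root_le i j
  exact h hx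

lemma pairing_highestRoot_nonneg (j : ι) (hj : j ∈ b.support) :
    0 ≤ P.pairing j b.highestRoot := by
  refine pairing_nonneg_symm (b.pairing_nonneg_of_maximal (fun d _ ↦ ?_) ⟨j, hj⟩)
  exact Finset.sum_le_sum fun k _ ↦ b.coord_root_le d k

/-- Each `m_i` is the maximum of the `i`-th coordinate on the polytope, so a proper convex
combination attains it only if both endpoints do. -/
lemma isExtreme_standardFace (I : Set b.support) :
    IsExtreme ℝ P.rootPolytope (b.standardFace I) := by
  refine ⟨fun x hx ↦ hx.1, ?_⟩
  rintro x hx y hy z hz ⟨s, t, hs, ht, hst, rfl⟩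
  refine ⟨hx, fun i hi ↦ ?_⟩
  have h := hz.2 i hi
  have h₁ := b.coord_le_of_mem_rootPolytope hx i
  have h₂ := b.coord_le_of_mem_rootPolytope hy i
  rw [map_add, map_smul, map_smul, smul_eq_mul, smul_eq_mul] at h
  refine le_antisymm h₁ ?_
  by_contra! hlt
  have : t = 1 - s := by linarith
  subst this
  nlinarith [mul_lt_mul_of_pos_left hlt hs, mul_le_mul_of_nonneg_left h₂ ht.le]

lemma highestRoot_mem_extremePoints (I : Set b.support) :
    P.root b.highestRoot ∈ (b.standardFace I).extremePoints ℝ := by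
  -- Prescribing all coordinates leaves only `θ`, which is thus itself an extreme subset of the
  -- polytope.
  have h : b.standardFace Set.univ = {P.root b.highestRoot} := by
    ext x
    refine ⟨fun hx ↦ b.toWeightBasis.ext_elem fun i ↦ hx.2 i trivial, ?_⟩
    rintro rfl
    exact ⟨root_mem_rootPolytope _, fun _ _ ↦ rfl⟩
  rw [(b.isExtreme_standardFace I).extremePoints_eq]
  refine ⟨⟨root_mem_rootPolytope _, fun _ _ ↦ rfl⟩, ?_⟩
  rw [← isExtreme_singleton, ← h]
  exact b.isExtreme_standardFace _

lemma extremePoints_standardFace_subset (I : Set b.support) :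
    (b.standardFace I).extremePoints ℝ ⊆ Set.range P.root :=
  (b.isExtreme_standardFace I).extremePoints_subset_extremePoints.trans
    extremePoints_convexHull_subset

lemma reflection_mem_standardFace {I : Set b.support} {j : b.support} (hj : j ∉ I) {x : M}
    (hx : x ∈ b.standardFace I) : P.reflection j x ∈ b.standardFace I := by
  refine ⟨reflection_mem_rootPolytope hx.1 j, fun i hi ↦ ?_⟩
  have hij : i ≠ j := by rintro rfl; exact hj hi
  rw [reflection_apply, map_sub, map_smul, b.coord_root_of_ne hij, smul_zero, sub_zero, hx.2 i hi]

lemma reflection_mem_extremePoints {I : Set b.support} {j : b.support} (hj : j ∉ I) {x : M}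
    (hx : x ∈ (b.standardFace I).extremePoints ℝ) :
    P.reflection j x ∈ (b.standardFace I).extremePoints ℝ := by
  have h : P.reflection j '' b.standardFace I = b.standardFace I := by
    refine Set.Subset.antisymm ?_ ?_
    · rintro - ⟨y, hy, rfl⟩
      exact b.reflection_mem_standardFace hj hy
    · exact fun y hy ↦ ⟨_, b.reflection_mem_standardFace hj hy, P.reflection_same _ y⟩
  rw [← h, ← image_extremePoints]
  exact Set.mem_image_of_mem _ hx

/-- A vertex of `F_I` that is dominant for the simple roots outside `I` is the highest root. -/
lemma eq_highestRoot_of_mem_extremePoints {I : Set b.support} {i : ι}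
    (hi : P.root i ∈ (b.standardFace I).extremePoints ℝ)
    (hdom : ∀ j : b.support, j ∉ I → 0 ≤ P.pairing j i) : i = b.highestRoot := by
  have hI := (extremePoints_subset hi).2
  -- The coordinates of `θ - α` (with `α` the root of index `i`) are nonnegative and vanish on `I`;
  -- off `I` the pairings with `α` are nonnegative. Hence `θ` pairs with the coroot of `α` at least
  -- as much as `α` does, namely 2.
  have hp : 2 ≤ P.pairing b.highestRoot i := by
    rw [← sub_nonneg, ← P.pairing_same i, b.pairing_eq_sum_coord b.highestRoot i,
      b.pairing_eq_sum_coord i i, ← Finset.sum_sub_distrib]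
    refine Finset.sum_nonneg fun j _ ↦ ?_
    rw [← sub_mul]
    by_cases hj : j ∈ I
    · rw [hI j hj, sub_self, zero_mul]
    · exact mul_nonneg (sub_nonneg.2 (b.coord_root_le i j)) (hdom j hj)
  set p := P.pairing b.highestRoot i with hp'
  set θ := P.root b.highestRoot with hθ
  have hext := (b.isExtreme_standardFace I).extremePoints_subset_extremePoints hi
  have hconv : Convex ℝ P.rootPolytope := convex_convexHull ℝ _
  have hzero : (0 : M) ∈ P.rootPolytope := by
    have := hconv (root_mem_rootPolytope (P := P) i) (neg_root_mem_rootPolytope i)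
      (a := 1 / 2) (b := 1 / 2) (by norm_num) (by norm_num) (by norm_num)
    simpa using this
  -- This vector is the negative of the reflection of `θ` in the root of index `i`, hence a root.
  have hy : p • P.root i - θ ∈ P.rootPolytope := by
    have := neg_root_mem_rootPolytope (P := P) (P.reflectionPerm i b.highestRoot)
    rwa [root_reflectionPerm, reflection_apply_root, neg_sub] at this
  have hp1 : 0 < p - 1 := by linarith
  have hy' : (p - 1)⁻¹ • (p • P.root i - θ) ∈ P.rootPolytope :=
    hconv.smul_mem_of_zero_mem hzero hy ⟨by positivity, inv_le_one_of_one_le₀ (by linarith)⟩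
  -- The weights `1/p` and `(p - 1)/p` recover the root; extremality then makes it equal to the
  -- endpoint `θ`.
  have hseg : P.root i ∈ openSegment ℝ θ ((p - 1)⁻¹ • (p • P.root i - θ)) := by
    have hp0 : 0 < p := by linarith
    refine ⟨p⁻¹, p⁻¹ * (p - 1), by positivity, by positivity, by field_simp; ring, ?_⟩
    rw [smul_smul, mul_assoc, mul_inv_cancel₀ hp1.ne', mul_one, smul_sub, smul_smul,
      inv_mul_cancel₀ hp0.ne', one_smul, add_sub_cancel]
  exact P.root.injective (hext.2 (root_mem_rootPolytope _) hy' hseg).symm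

/-- The vertices of `F_I` are the translates of the highest root under the parabolic subgroup
generated by the simple reflections outside `J`, where `J` is obtained from `I` by adding simple
roots orthogonal to the highest root and to the simple roots outside `J`. -/
theorem extremePoints_standardFace_eq {I J : Set b.support} (hIJ : I ⊆ J)
    (hθ : ∀ k ∈ J, k ∉ I → P.IsOrthogonal k b.highestRoot)
    (hJ : ∀ k ∈ J, k ∉ I → ∀ j ∉ J, P.IsOrthogonal (k : ι) j) :
    (b.standardFace I).extremePoints ℝ =
      {x | ∃ w ∈ P.reflectionSubgroup (b.simpleRootsDiff J), w (P.root b.highestRoot) = x} := by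
  -- The orbit is stable under every simple reflection outside `I`, including those in `J ∖ I`,
  -- which commute past `w` and fix `θ`.
  have hout (k : b.support) (hk : k ∉ I) (w : M ≃ₗ[ℝ] M)
      (hw : w ∈ P.reflectionSubgroup (b.simpleRootsDiff J)) :
      ∃ w' ∈ P.reflectionSubgroup (b.simpleRootsDiff J),
        w' (P.root b.highestRoot) = P.reflection k (w (P.root b.highestRoot)) := by
    by_cases hkJ : k ∈ J
    · refine ⟨w, hw, ?_⟩
      have hcomm : Commute (P.reflection k) w := by
        induction hw using Subgroup.closure_induction with
        | mem x hx =>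
          obtain ⟨-, ⟨j, hj, rfl⟩, rfl⟩ := hx
          exact P.isOrthogonal_comm _ _ (hJ k hkJ hk j hj)
        | one => exact Commute.one_right _
        | mul x y _ _ hx hy => exact hx.mul_right hy
        | inv x _ hx => exact hx.inv_right
      rw [← LinearEquiv.mul_apply, hcomm.eq, LinearEquiv.mul_apply,
        IsOrthogonal.reflection_apply_right (hθ k hkJ hk)]
    · exact ⟨P.reflection k * w, mul_mem (Subgroup.subset_closure ⟨k, ⟨k, hkJ, rfl⟩, rfl⟩) hw, rfl⟩
  apply Set.Subset.antisymm
  · intro x hx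
    by_contra hx'
    set O := {x | ∃ w ∈ P.reflectionSubgroup (b.simpleRootsDiff J), w (P.root b.highestRoot) = x}
    obtain ⟨i₀, rfl⟩ := b.extremePoints_standardFace_subset I hx
    -- Among the vertices outside the orbit take one of maximal height. A negative pairing with some
    -- `α_j`, `j ∉ I`, would let `s_j` raise it while it stays a vertex outside the orbit.
    obtain ⟨i, ⟨hi, hiO⟩, hmax⟩ := Set.exists_max_image
      {i | P.root i ∈ (b.standardFace I).extremePoints ℝ ∧ P.root i ∉ O} b.height
      (Set.toFinite _) ⟨i₀, hx, hx'⟩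
    refine hiO ?_
    suffices i = b.highestRoot from ⟨1, one_mem _, by rw [this]; rfl⟩
    refine b.eq_highestRoot_of_mem_extremePoints hi fun j hj ↦ ?_
    suffices 0 ≤ P.pairingIn ℤ i j from pairing_nonneg_symm this
    by_contra! hneg
    have hroot : P.root (P.reflectionPerm j i) = P.root i + (-P.pairingIn ℤ i j) • P.root j := by
      rw [root_reflectionPerm, neg_smul, reflection_apply_root' ℤ, sub_eq_add_neg]
    have hheight := b.height_add_zsmul hroot
    rw [height_one_of_mem_support j.2, smul_eq_mul, mul_one] at hheight
    have hle := hmax (P.reflectionPerm j i) ⟨?_, fun h ↦ hiO ?_⟩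
    · omega
    · rw [root_reflectionPerm]
      exact b.reflection_mem_extremePoints hj hi
    · obtain ⟨w, hw, h⟩ := h
      obtain ⟨w', hw', h'⟩ := hout j hj w hw
      exact ⟨w', hw', by rw [h', h, root_reflectionPerm, reflection_same]⟩
  · rintro - ⟨w, hw, rfl⟩
    obtain ⟨L, hL, rfl⟩ := P.exists_wordReflection_eq hw
    clear hw
    induction L with
    | nil => exact b.highestRoot_mem_extremePoints I
    | cons k L ih =>
      obtain ⟨j, hj, rfl⟩ := hL k (by simp)
      rw [wordReflection_cons, LinearEquiv.mul_apply]
      exact b.reflection_mem_extremePoints (fun h ↦ hj (hIJ h)) (ih fun i hi ↦ hL i (by simp [hi]))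

/-! ### The closure of `I` via the affine root system -/

/-- The relation is linear and holds on the generators: `α₀` has `i`-th coordinate `-m_i` and
`δ`-coefficient 1, and the remaining simple roots have zero for both. -/
lemma coord_eq_of_mem_affineSubsystem {I : Set b.support} {a : ι × ℤ}
    (ha : a ∈ P.affineSubsystem (b.affineSimpleRootsDiff I)) {i : b.support} (hi : i ∈ I) :
    b.toWeightBasis.coord i (P.affineRoot a).1 =
      -((P.affineRoot a).2 * b.toWeightBasis.coord i (P.root b.highestRoot)) := by
  induction ha with
  | of a ha =>
    rcases ha with rfl | ⟨j, hj, rfl⟩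
    · simp [affineRoot_affineSimpleRoot]
    · have hij : i ≠ j := by rintro rfl; exact hj hi
      have := b.coord_root_of_ne hij
      simpa [affineRoot] using this
  | reflect a c _ _ h₁ h₂ =>
    rw [affineRoot_affineReflection, Prod.fst_sub, Prod.snd_sub, Prod.smul_fst, Prod.smul_snd,
      map_sub, map_smul, h₁, h₂, smul_eq_mul, smul_eq_mul]
    ring

/-- For `k ∈ I`, the root `α_k` has coordinate 1 but `δ`-coefficient 0, so it is not even in the
generated subsystem. -/
lemma subset_faceClosure (I : Set b.support) : I ⊆ b.faceClosure I := by
  intro k hk h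
  have hmem : ((k : ι), (0 : ℤ)) ∈ P.affineSubsystem (b.affineSimpleRootsDiff I) := by
    rcases Relation.ReflTransGen.cases_tail h.2 with h' | ⟨_, _, h', _⟩
    · exact h' ▸ h.1
    · exact h'
  have := b.coord_eq_of_mem_affineSubsystem hmem hk
  simp only [affineRoot, Int.cast_zero, zero_mul, neg_zero, b.coord_root_self] at this
  exact one_ne_zero this

/-- As `k ∉ I`, `α_k` is a generator of the subsystem; if it were not orthogonal to `a`, it would
extend the path from `α₀` to `a` and lie in the component. -/
lemma isOrthogonal_of_mem_faceClosure {I : Set b.support} {k : b.support}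
    (hk : k ∈ b.faceClosure I) (hkI : k ∉ I) {a : ι × ℤ}
    (ha : a ∈ P.affineComponent (P.affineSubsystem (b.affineSimpleRootsDiff I))
      b.affineSimpleRoot) : P.IsOrthogonal (k : ι) a.1 := by
  by_contra h
  refine hk ⟨ha.1, ha.2.tail ⟨.of _ (Or.inr ⟨k, hkI, rfl⟩), ?_⟩⟩
  rwa [isOrthogonal_symm]

lemma isOrthogonal_highestRoot_of_mem_faceClosure {I : Set b.support} {k : b.support}
    (hk : k ∈ b.faceClosure I) (hkI : k ∉ I) : P.IsOrthogonal k b.highestRoot := by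
  have h := b.isOrthogonal_of_mem_faceClosure hk hkI (a := b.affineSimpleRoot)
    ⟨.of _ (Or.inl rfl), .refl⟩
  simpa [affineSimpleRoot, IsOrthogonal] using h

end Vertices

end RootPairing.Base

/-- The number of vertices of the standard parabolic face `F_I` is the index
`[W⟨Π ∖ Π_Ī⟩ : W⟨(Π ∖ Π_Ī) ∩ θ^⊥⟩]`. -/
theorem corollary3p11 {ι M N : Type*} [Finite ι] [AddCommGroup M] [Module ℝ M]
    [AddCommGroup N] [Module ℝ N] (P : RootPairing ι ℝ M N) [P.IsRootSystem]
    [P.IsCrystallographic] [P.IsReduced] [P.IsIrreducible] (b : P.Base) (I : Set b.support) :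
    (Set.extremePoints ℝ (b.standardFace I)).Finite ∧
    P.reflectionSubgroup (b.simpleRootsDiff (b.faceClosure I) ∩ b.orthogonalToHighestRoot) ≤
      P.reflectionSubgroup (b.simpleRootsDiff (b.faceClosure I)) ∧
    (Set.extremePoints ℝ (b.standardFace I)).ncard =
      (P.reflectionSubgroup
        (b.simpleRootsDiff (b.faceClosure I) ∩ b.orthogonalToHighestRoot)).relIndex
        (P.reflectionSubgroup (b.simpleRootsDiff (b.faceClosure I))) := by
  refine ⟨(Set.finite_range P.root).subset (b.extremePoints_standardFace_subset I),
    P.reflectionSubgroup_mono Set.inter_subset_left, ?_⟩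
  -- Both orthogonality conditions come from the component of `α₀`: it contains `α₀`, whose finite
  -- part is `-θ`, and every `α_j` with `j ∉ Ī`.
  rw [b.extremePoints_standardFace_eq (b.subset_faceClosure I)
    (fun k ↦ b.isOrthogonal_highestRoot_of_mem_faceClosure)
    (fun k hk hkI j hj ↦ b.isOrthogonal_of_mem_faceClosure hk hkI (not_not.1 hj))]
  refine b.ncard_orbit_eq_relIndex b.pairing_highestRoot_nonneg ?_
  rintro - ⟨j, -, rfl⟩
  exact j.2
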